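/- Let $E|K$ be a finite separable field extension, let $\mathrm{Tr}$ be the trace of $E$ over $K$, and let $(b_i)$, $(d_i)$ be $K$-bases of $E$ that are dual under the trace form, $\mathrm{Tr}(b_i d_j)=\delta_{ij}$. Let $\mathcal{A}=\mathrm{End}\,E_K$ be the algebra of $K$-linear endomorphisms of $E$, and for $a\in E$ let $\lambda_a\in\mathcal{A}$ be multiplication by $a$. Equip $\mathcal{A}$ with the coproduct, counit and antipode $$\Delta(\alpha)=\sum_{i,k}\lambda_{b_i}\,\mathrm{Tr}(d_k\,\cdot\,)\otimes_K \lambda_{d_i}\,\alpha\,\lambda_{b_k},\qquad \varepsilon(\alpha)=\mathrm{Tr}(\alpha(1)),\qquad S(\alpha)(x)=\sum_i b_i\,\mathrm{Tr}(x\,\alpha(d_i)).$$ Then $(\mathcal{A},\Delta,\varepsilon,S)$ is a weak Hopf algebra over $K$. Call a $K$-subalgebra $W\subseteq\mathcal{A}$ a weak Hopf subalgebra if $\Delta(W)\subseteq W\otimes_K W$ and $S(W)\subseteq W$. For an intermediate field $K\subseteq F\subseteq E$ put $$\mathrm{Gal}(F)=\{\alpha\in\mathcal{A}\mid \alpha(xy)=\alpha(x)y\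 \text{ for all } x\in E,\ y\in F\}=\mathrm{End}\,E_F,$$ and for a weak Hopf subalgebra $W$ of $\mathcal{A}$ that contains $\lambda(E)$ put $$\mathrm{Fix}(W)=E^W=\{x\in E\mid \alpha(x)=\alpha(1)x\ \text{ for all } \alpha\in W\}.$$ **Corollary 7.2.** $\mathrm{Gal}(F)$ is a weak Hopf subalgebra of $\mathcal{A}$ containing $\lambda(E)$ for every intermediate field $F$, $\mathrm{Fix}(W)$ is an intermediate field of $E|K$ for every weak Hopf subalgebra $W$ of $\mathcal{A}$ containing $\lambda(E)$, and $\mathrm{Gal}$ and $\mathrm{Fix}$ are mutually inverse bijections: $\mathrm{Fix}(\mathrm{Gal}(F))=F$ and $\mathrm{Gal}(\mathrm{Fix}(W))=W$. -/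

import Mathlib

open scoped TensorProduct

section WeakHopf

variable {K H : Type*} [CommRing K] [Ring H] [Algebra K H]

/-- The axioms of a weak Hopf algebra (Böhm, Nill, Szlachányi) for an associative unital algebra
`H` over `K` with coproduct `Δ`, counit `ε` and antipode `S`. In Sweedler notation, the summands
of `Δ x` are written `x₁ ⊗ x₂`. The coproduct need not preserve `1` and the counit need not be
multiplicative. -/
structure IsWeakHopfAlgebra (Δ : H →ₗ[K] H ⊗[K] H) (ε : H →ₗ[K] K) (S : H →ₗ[K] H) : Prop where
  /-- `(Δ ⊗ id) ∘ Δ = (id ⊗ Δ) ∘ Δ` -/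
  coassoc : TensorProduct.assoc K H H H ∘ₗ Δ.rTensor H ∘ₗ Δ = Δ.lTensor H ∘ₗ Δ
  /-- `ε(x₁) x₂ = x` -/
  counit_left (x : H) : TensorProduct.lid K H (ε.rTensor H (Δ x)) = x
  /-- `x₁ ε(x₂) = x` -/
  counit_right (x : H) : TensorProduct.rid K H (ε.lTensor H (Δ x)) = x
  /-- `Δ(x y) = Δ(x) Δ(y)` -/
  comul_mul (x y : H) : Δ (x * y) = Δ x * Δ y
  /-- `(id ⊗ Δ)(Δ(1)) = (Δ(1) ⊗ 1)(1 ⊗ Δ(1))` -/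
  comul_one : Δ.lTensor H (Δ 1) =
    TensorProduct.assoc K H H H (Δ 1 ⊗ₜ[K] (1 : H)) * ((1 : H) ⊗ₜ[K] Δ 1)
  /-- `(id ⊗ Δ)(Δ(1)) = (1 ⊗ Δ(1))(Δ(1) ⊗ 1)` -/
  comul_one' : Δ.lTensor H (Δ 1) =
    ((1 : H) ⊗ₜ[K] Δ 1) * TensorProduct.assoc K H H H (Δ 1 ⊗ₜ[K] (1 : H))
  /-- `ε(x y z) = ε(x y₁) ε(y₂ z)` -/
  counit_mul (x y z : H) : ε (x * y * z) =
    LinearMap.mul' K K (TensorProduct.map (ε ∘ₗ LinearMap.mulLeft K x)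
      (ε ∘ₗ LinearMap.mulRight K z) (Δ y))
  /-- `ε(x y z) = ε(x y₂) ε(y₁ z)` -/
  counit_mul' (x y z : H) : ε (x * y * z) =
    LinearMap.mul' K K (TensorProduct.map (ε ∘ₗ LinearMap.mulRight K z)
      (ε ∘ₗ LinearMap.mulLeft K x) (Δ y))
  /-- `x₁ S(x₂) = ε(1₁ x) 1₂` -/
  mul_antipode (x : H) : LinearMap.mul' K H (S.lTensor H (Δ x)) =
    TensorProduct.lid K H ((ε ∘ₗ LinearMap.mulRight K x).rTensor H (Δ 1))
  /-- `S(x₁) x₂ = 1₁ ε(x 1₂)` -/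
  antipode_mul (x : H) : LinearMap.mul' K H (S.rTensor H (Δ x)) =
    TensorProduct.rid K H ((ε ∘ₗ LinearMap.mulLeft K x).lTensor H (Δ 1))
  /-- `S(x₁) x₂ S(x₃) = S(x)` -/
  antipode_mul_antipode (x : H) :
    LinearMap.mul' K H
      (TensorProduct.map (LinearMap.mul' K H ∘ₗ S.rTensor H ∘ₗ Δ) S (Δ x)) = S x

/-- A weak Hopf subalgebra: a (unital) subalgebra `W` with `Δ(W) ⊆ W ⊗ W` and `S(W) ⊆ W`, where
`W ⊗ W` stands for its image in `H ⊗ H`. -/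
structure IsWeakHopfSubalgebra (Δ : H →ₗ[K] H ⊗[K] H) (S : H →ₗ[K] H)
    (W : Subalgebra K H) : Prop where
  comul_mem : ∀ x ∈ W, Δ x ∈ LinearMap.range
    (TensorProduct.mapIncl (Subalgebra.toSubmodule W) (Subalgebra.toSubmodule W))
  antipode_mem : ∀ x ∈ W, S x ∈ W

end WeakHopf

section FieldExtension

variable (K E : Type*) [Field K] [Field E] [Algebra K E]

section Structure

variable [FiniteDimensional K E] [Algebra.IsSeparable K E]

/-- A `K`-basis `bᵢ` of `E`. The weak Hopf structure below does not depend on the choice. -/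
noncomputable def endBasis : Module.Basis (Fin (Module.finrank K E)) K E :=
  Module.finBasis K E

/-- The basis `dᵢ` of `E` that is dual to `bᵢ` under the trace form: `Tr(bᵢ dⱼ) = δᵢⱼ`. -/
noncomputable def endDualBasis : Module.Basis (Fin (Module.finrank K E)) K E :=
  (endBasis K E).traceDual

/-- The coproduct of `End E_K`. The `E`-bialgebroid `End E_K` has the coproduct
`α ↦ ∑ k, Tr(dₖ -) ⊗ α(bₖ -)` with values in `End E_K ⊗_E End E_K`, characterized by
`α₁(x) α₂(y) = α(x y)`; it is lifted to `End E_K ⊗_K End E_K` by multiplication with the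
separability idempotent `∑ i, bᵢ ⊗ dᵢ` of `E`. -/
noncomputable def endComul : Module.End K E →ₗ[K] Module.End K E ⊗[K] Module.End K E :=
  ∑ k, ∑ i,
    TensorProduct.mk K (Module.End K E) (Module.End K E)
        (Algebra.lmul K E (endBasis K E i) *
          (Algebra.linearMap K E ∘ₗ Algebra.traceForm K E (endDualBasis K E k))) ∘ₗ
      LinearMap.mulLeft K (Algebra.lmul K E (endDualBasis K E i)) ∘ₗ
      LinearMap.mulRight K (Algebra.lmul K E (endBasis K E k))

/-- The counit of `End E_K`: `ε(α) = Tr(α(1))`, the bialgebroid counit `α ↦ α(1)` followed by the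
trace of `E` over `K`. -/
noncomputable def endCounit : Module.End K E →ₗ[K] K :=
  Algebra.trace K E ∘ₗ LinearMap.applyₗ (1 : E)

/-- The antipode of `End E_K`: `S(α)(x) = ∑ i, Tr(x α(dᵢ)) bᵢ`, the adjoint of `α` with respect to
the trace form. -/
noncomputable def endAntipode : Module.End K E →ₗ[K] Module.End K E :=
  ∑ i, (LinearMap.toSpanSingleton K E (endBasis K E i)).compRight K ∘ₗ
    (Algebra.traceForm K E).flip ∘ₗ LinearMap.applyₗ (endDualBasis K E i)

theorem endComul_apply (α : Module.End K E) : endComul K E α = ∑ k, ∑ i,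
    (Algebra.lmul K E (endBasis K E i) *
      (Algebra.linearMap K E ∘ₗ Algebra.traceForm K E (endDualBasis K E k))) ⊗ₜ[K]
    (Algebra.lmul K E (endDualBasis K E i) * α * Algebra.lmul K E (endBasis K E k)) := by
  simp [endComul, LinearMap.sum_apply, mul_assoc]

theorem endAntipode_apply (α : Module.End K E) (x : E) : endAntipode K E α x =
    ∑ i, Algebra.trace K E (x * α (endDualBasis K E i)) • endBasis K E i := by
  simp [endAntipode, LinearMap.sum_apply, Algebra.traceForm_apply]

end Structure

variable {K E}

/-- `Gal(F) = {α | α(x y) = α(x) y for all x ∈ E, y ∈ F}`, the `F`-linear endomorphisms of `E`,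
as a subalgebra of `End E_K`. -/
def endGal (F : IntermediateField K E) : Subalgebra K (Module.End K E) where
  carrier := {α | ∀ x : E, ∀ y ∈ F, α (x * y) = α x * y}
  mul_mem' := fun {α β} hα hβ x y hy => by
    simp [hβ x y hy, hα _ y hy]
  add_mem' := fun {α β} hα hβ x y hy => by
    simp [hβ x y hy, hα x y hy, add_mul]
  algebraMap_mem' := fun r x y _ => by
    simp [Module.algebraMap_end_apply]

theorem lmul_range_le_endGal (F : IntermediateField K E) :
    (Algebra.lmul K E).range ≤ endGal F := by
  rintro _ ⟨a, rfl⟩ x y _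
  simp [mul_assoc]

/-- `Gal(F) = End E_F`. -/
theorem mem_endGal_iff (F : IntermediateField K E) (α : Module.End K E) :
    α ∈ endGal F ↔ ∃ β : Module.End F E, β.restrictScalars K = α := by
  constructor
  · intro h
    refine ⟨{ toFun := α, map_add' := α.map_add, map_smul' := fun c x => ?_ }, rfl⟩
    have := h x c c.2
    simpa [Algebra.smul_def, mul_comm] using this
  · rintro ⟨β, rfl⟩ x y hy
    have := β.map_smul (⟨y, hy⟩ : F) x
    simpa [Algebra.smul_def, mul_comm] using this

/-- `Fix(W) = E^W = {x ∈ E | α(x) = α(1) x for all α ∈ W}`, an intermediate field when `W` is a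
subalgebra of `End E_K` that contains the left multiplications `λ(E)`. -/
def endFix (W : Subalgebra K (Module.End K E)) (hW : (Algebra.lmul K E).range ≤ W) :
    IntermediateField K E where
  carrier := {x | ∀ α ∈ W, α x = α 1 * x}
  mul_mem' := fun {x y} hx hy α hα => by
    have := hy (α * Algebra.lmul K E x) (W.mul_mem hα (hW ⟨x, rfl⟩))
    simp only [Module.End.mul_apply, Algebra.coe_lmul_eq_mul, LinearMap.mul_apply', mul_one] at this
    rw [this, hx α hα, mul_assoc]
  add_mem' := fun {x y} hx hy α hα => by
    rw [map_add, hx α hα, hy α hα, mul_add]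
  algebraMap_mem' := fun r α _ => by
    rw [Algebra.algebraMap_eq_smul_one, map_smul, mul_smul_comm, mul_one]
  inv_mem' := fun x hx α hα => by
    rcases eq_or_ne x 0 with rfl | h0
    · simp
    have := hx (α * Algebra.lmul K E x⁻¹) (W.mul_mem hα (hW ⟨x⁻¹, rfl⟩))
    simp only [Module.End.mul_apply, Algebra.coe_lmul_eq_mul, LinearMap.mul_apply', mul_one,
      inv_mul_cancel₀ h0] at this
    rw [this, mul_assoc, mul_inv_cancel₀ h0, mul_one]

end FieldExtension

/-! ### The trace form as a Frobenius structure on `E`. -/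

section TraceDual

variable (K E : Type*) [Field K] [Field E] [Algebra K E]
variable [FiniteDimensional K E] [Algebra.IsSeparable K E]

/-! Let `μ` be the multiplication of `E` and `δ = traceComul` its trace adjoint. `End E ⊗ End E`
acts faithfully on `E ⊗ E`, and there `Δ(α)` is `δ ∘ α ∘ μ` (`endTensorAct_endComul`). The coalgebra
axioms thus reduce to Frobenius identities: `δ` is a coassociative bimodule map with counit the
trace, and `μ ∘ δ = id` since `∑ bᵢ dᵢ = 1`. The antipode axioms follow because `S` is the trace
adjoint.

`Gal(F)` is closed under `Δ` because the expansion of `x` can be taken over `F`, with `F`-linear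
tensor factors, and under `S` because `F` acts by self-adjoint maps. An `F`-linear retraction of `E`
onto `F` gives `Fix(Gal(F)) = F`. For `Gal(Fix(W)) = W`, `λ(E) ⊆ W` makes `E` a simple `W`-module
whose endomorphisms are multiplications by elements of `Fix(W)`; Jacobson density concludes. -/

theorem sum_trace_endDualBasis_mul_smul (x : E) :
    ∑ k, Algebra.trace K E (endDualBasis K E k * x) • endBasis K E k = x := by
  conv_rhs => rw [← (endBasis K E).sum_repr x]
  refine Finset.sum_congr rfl fun k _ => ?_
  have h := (endBasis K E).traceDual.traceDual_repr_apply x k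
  rw [Module.Basis.traceDual_traceDual] at h
  rw [h, Algebra.traceForm_apply, mul_comm, endDualBasis]

theorem sum_trace_endBasis_mul_smul (x : E) :
    ∑ k, Algebra.trace K E (endBasis K E k * x) • endDualBasis K E k = x := by
  conv_rhs => rw [← (endDualBasis K E).sum_repr x]
  refine Finset.sum_congr rfl fun k _ => ?_
  rw [endDualBasis, (endBasis K E).traceDual_repr_apply x k, Algebra.traceForm_apply, mul_comm]

variable {E} in
theorem eq_of_trace_mul_eq {x y : E}
    (h : ∀ w, Algebra.trace K E (x * w) = Algebra.trace K E (y * w)) : x = y := by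
  rw [← sum_trace_endBasis_mul_smul K E x, ← sum_trace_endBasis_mul_smul K E y]
  simp only [mul_comm _ x, mul_comm _ y, h]

/-- The matrix trace of multiplication by `w` is `∑ Tr(w bᵢ dᵢ)`, so pairing either side with `w`
gives `Tr(w)`. -/
theorem sum_endBasis_mul_endDualBasis : ∑ i, endBasis K E i * endDualBasis K E i = 1 := by
  refine eq_of_trace_mul_eq K fun w => ?_
  rw [one_mul, mul_comm, Finset.mul_sum, map_sum, Algebra.trace_eq_matrix_trace (endBasis K E) w,
    Matrix.trace]
  refine Finset.sum_congr rfl fun i _ => ?_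
  have h := (endBasis K E).traceDual.traceDual_repr_apply (w * endBasis K E i) i
  rw [Module.Basis.traceDual_traceDual] at h
  rw [Matrix.diag_apply, Algebra.leftMulMatrix_eq_repr_mul, h, Algebra.traceForm_apply,
    endDualBasis, mul_assoc]

/-- In the basis `bⱼ ⊗ dᵢ` both sides have coefficients `Tr(dⱼ x bᵢ)`. -/
theorem sum_mul_endBasis_tmul (x : E) :
    ∑ i, (x * endBasis K E i) ⊗ₜ[K] endDualBasis K E i =
      ∑ i, endBasis K E i ⊗ₜ[K] (endDualBasis K E i * x) := by
  have h1 (i) : (x * endBasis K E i) ⊗ₜ[K] endDualBasis K E i = ∑ j,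
      Algebra.trace K E (endDualBasis K E j * (x * endBasis K E i)) •
        (endBasis K E j ⊗ₜ[K] endDualBasis K E i) := by
    conv_lhs => rw [← sum_trace_endDualBasis_mul_smul K E (x * endBasis K E i)]
    simp only [TensorProduct.sum_tmul, TensorProduct.smul_tmul']
  have h2 (i) : endBasis K E i ⊗ₜ[K] (endDualBasis K E i * x) = ∑ j,
      Algebra.trace K E (endBasis K E j * (endDualBasis K E i * x)) •
        (endBasis K E i ⊗ₜ[K] endDualBasis K E j) := by
    conv_lhs => rw [← sum_trace_endBasis_mul_smul K E (endDualBasis K E i * x)]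
    simp only [TensorProduct.tmul_sum, TensorProduct.tmul_smul]
  simp only [h1, h2]
  rw [Finset.sum_comm]
  refine Finset.sum_congr rfl fun i _ => Finset.sum_congr rfl fun j _ => ?_
  congr 2
  ring

/-- The Frobenius comultiplication `a ↦ ∑ i, bᵢ ⊗ dᵢ a`, the adjoint of the multiplication of `E`
under the trace form. -/
noncomputable def traceComul : E →ₗ[K] E ⊗[K] E :=
  ∑ i, TensorProduct.mk K E E (endBasis K E i) ∘ₗ LinearMap.mulLeft K (endDualBasis K E i)

theorem traceComul_apply (a : E) :
    traceComul K E a = ∑ i, endBasis K E i ⊗ₜ[K] (endDualBasis K E i * a) := by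
  simp [traceComul]

/-- The comultiplication is a homomorphism of bimodules. -/
theorem traceComul_mul (a c : E) :
    traceComul K E (a * c) = ∑ i, (a * endBasis K E i) ⊗ₜ[K] (endDualBasis K E i * c) := by
  have h := congrArg (LinearMap.lTensor E (LinearMap.mulRight K c))
    (sum_mul_endBasis_tmul K E a)
  simp only [map_sum, LinearMap.lTensor_tmul, LinearMap.mulRight_apply] at h
  rw [h, traceComul_apply]
  simp only [mul_assoc]

theorem traceComul_coassoc (a : E) :
    TensorProduct.assoc K E E E ((traceComul K E).rTensor E (traceComul K E a)) =
      (traceComul K E).lTensor E (traceComul K E a) := by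
  conv_lhs => rw [traceComul_apply]
  conv_rhs => rw [traceComul_apply]
  simp only [map_sum, LinearMap.lTensor_tmul, LinearMap.rTensor_tmul]
  conv_rhs => enter [2, i]; rw [traceComul_mul, TensorProduct.tmul_sum]
  conv_lhs => enter [2, i]; rw [traceComul_apply, TensorProduct.sum_tmul, map_sum]
  simp only [TensorProduct.assoc_tmul]
  rw [Finset.sum_comm]

end TraceDual

/-! ### Faithful actions on tensor powers of `E`. -/

section Realization

variable (K E : Type*) [Field K] [Field E] [Algebra K E]

/-- The action of `End E ⊗ End E` on `E ⊗ E`. -/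
noncomputable def endTensorAct :
    Module.End K E ⊗[K] Module.End K E →ₐ[K] Module.End K (E ⊗[K] E) :=
  Module.endTensorEndAlgHom

/-- The action of `End E ⊗ (End E ⊗ End E)` on `E ⊗ (E ⊗ E)`. -/
noncomputable def endTensorAct₃ : Module.End K E ⊗[K] (Module.End K E ⊗[K] Module.End K E) →ₐ[K]
    Module.End K (E ⊗[K] (E ⊗[K] E)) :=
  (Module.endTensorEndAlgHom (M := E) (N := E ⊗[K] E)).comp
    (Algebra.TensorProduct.map (AlgHom.id K _) (endTensorAct K E))

@[simp]
theorem endTensorAct_tmul (α β : Module.End K E) :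
    endTensorAct K E (α ⊗ₜ β) = TensorProduct.map α β := rfl

@[simp]
theorem endTensorAct₃_tmul (α : Module.End K E) (t : Module.End K E ⊗[K] Module.End K E) :
    endTensorAct₃ K E (α ⊗ₜ t) = TensorProduct.map α (endTensorAct K E t) := rfl

theorem endTensorAct_eq_homTensorHomMap (t : Module.End K E ⊗[K] Module.End K E) :
    endTensorAct K E t = TensorProduct.homTensorHomMap (RingHom.id K) E E E E t := by
  induction t with
  | zero => simp
  | add t₁ t₂ h₁ h₂ => simp only [map_add, h₁, h₂]
  | tmul α β => rfl

theorem endTensorAct₃_eq_homTensorHomMap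
    (t : Module.End K E ⊗[K] (Module.End K E ⊗[K] Module.End K E)) :
    endTensorAct₃ K E t = TensorProduct.homTensorHomMap (RingHom.id K) E (E ⊗[K] E) E (E ⊗[K] E)
      ((endTensorAct K E).toLinearMap.lTensor (Module.End K E) t) := by
  induction t with
  | zero => simp
  | add t₁ t₂ h₁ h₂ => simp only [map_add, h₁, h₂]
  | tmul α β => rfl

theorem endTensorAct_injective [FiniteDimensional K E] :
    Function.Injective (endTensorAct K E) := by
  have h := (homTensorHomEquiv K E E E E).injective
  rw [← LinearEquiv.coe_toLinearMap, homTensorHomEquiv_toLinearMap] at h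
  intro s t hst
  rw [endTensorAct_eq_homTensorHomMap, endTensorAct_eq_homTensorHomMap] at hst
  exact h hst

/-- Flatness over `K` keeps the two-factor injection injective after tensoring with `End E`. -/
theorem endTensorAct₃_injective [FiniteDimensional K E] :
    Function.Injective (endTensorAct₃ K E) := by
  have h := (homTensorHomEquiv K E (E ⊗[K] E) E (E ⊗[K] E)).injective
  rw [← LinearEquiv.coe_toLinearMap, homTensorHomEquiv_toLinearMap] at h
  intro s t hst
  rw [endTensorAct₃_eq_homTensorHomMap, endTensorAct₃_eq_homTensorHomMap] at hst
  exact Module.Flat.lTensor_preserves_injective_linearMap (endTensorAct K E).toLinearMap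
    (endTensorAct_injective K E) (h hst)

theorem endTensorAct₃_assoc_tmul (t : Module.End K E ⊗[K] Module.End K E) (β : Module.End K E) :
    endTensorAct₃ K E (TensorProduct.assoc K _ _ _ (t ⊗ₜ β)) =
      TensorProduct.assoc K E E E ∘ₗ TensorProduct.map (endTensorAct K E t) β ∘ₗ
        (TensorProduct.assoc K E E E).symm := by
  induction t with
  | zero => simp
  | add t₁ t₂ h₁ h₂ =>
    simp only [TensorProduct.add_tmul, map_add, h₁, h₂, TensorProduct.map_add_left,
      LinearMap.add_comp, LinearMap.comp_add]
  | tmul α γ => ext x y z; simp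

/-- This and the next three lemmas express the counit terms of the axioms through the action on `E ⊗
E`, where `Δ` is explicit. -/
theorem lid_rTensor_endCounit (x : Module.End K E) (t : Module.End K E ⊗[K] Module.End K E)
    (v : E) : TensorProduct.lid K _ ((endCounit K E ∘ₗ LinearMap.mulRight K x).rTensor _ t) v =
      TensorProduct.lid K E ((Algebra.trace K E).rTensor E (endTensorAct K E t (x 1 ⊗ₜ v))) := by
  induction t with
  | zero => simp
  | add t₁ t₂ h₁ h₂ => simp only [map_add, LinearMap.add_apply, h₁, h₂]
  | tmul α β => simp [endCounit]

theorem rid_lTensor_endCounit (x : Module.End K E) (t : Module.End K E ⊗[K] Module.End K E)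
    (v : E) : TensorProduct.rid K _ ((endCounit K E ∘ₗ LinearMap.mulLeft K x).lTensor _ t) v =
      TensorProduct.rid K E
        ((Algebra.trace K E ∘ₗ x).lTensor E (endTensorAct K E t (v ⊗ₜ 1))) := by
  induction t with
  | zero => simp
  | add t₁ t₂ h₁ h₂ => simp only [map_add, LinearMap.add_apply, h₁, h₂]
  | tmul α β => simp [endCounit]

theorem mul'_map_endCounit (x z : Module.End K E) (t : Module.End K E ⊗[K] Module.End K E) :
    LinearMap.mul' K K (TensorProduct.map (endCounit K E ∘ₗ LinearMap.mulLeft K x)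
      (endCounit K E ∘ₗ LinearMap.mulRight K z) t) =
    Algebra.trace K E (x (TensorProduct.rid K E
      ((Algebra.trace K E).lTensor E (endTensorAct K E t (1 ⊗ₜ z 1))))) := by
  induction t with
  | zero => simp
  | add t₁ t₂ h₁ h₂ => simp only [map_add, LinearMap.add_apply, h₁, h₂]
  | tmul α β => simp [endCounit, mul_comm]

theorem mul'_map_endCounit' (x z : Module.End K E) (t : Module.End K E ⊗[K] Module.End K E) :
    LinearMap.mul' K K (TensorProduct.map (endCounit K E ∘ₗ LinearMap.mulRight K z)
      (endCounit K E ∘ₗ LinearMap.mulLeft K x) t) =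
    Algebra.trace K E (x (TensorProduct.lid K E
      ((Algebra.trace K E).rTensor E (endTensorAct K E t (z 1 ⊗ₜ 1))))) := by
  induction t with
  | zero => simp
  | add t₁ t₂ h₁ h₂ => simp only [map_add, LinearMap.add_apply, h₁, h₂]
  | tmul α β => simp [endCounit]

end Realization

/-! ### Coproduct axioms read on `E ⊗ E` and `E ⊗ E ⊗ E`. -/

section Comul

variable (K E : Type*) [Field K] [Field E] [Algebra K E]
variable [FiniteDimensional K E] [Algebra.IsSeparable K E]

/-- `Δ(α)` acts on `E ⊗ E` as multiplication, then `α`, then the Frobenius comultiplication. -/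
theorem endTensorAct_endComul (α : Module.End K E) :
    endTensorAct K E (endComul K E α) = traceComul K E ∘ₗ α ∘ₗ LinearMap.mul' K E := by
  ext x y
  have h : α (x * y) = ∑ k, Algebra.trace K E (endDualBasis K E k * x) • α (endBasis K E k * y) := by
    conv_lhs => rw [← sum_trace_endDualBasis_mul_smul K E x]
    simp only [Finset.sum_mul, map_sum, smul_mul_assoc, map_smul]
  simp only [TensorProduct.AlgebraTensorModule.curry_apply, TensorProduct.curry_apply,
    LinearMap.coe_restrictScalars, LinearMap.comp_apply, LinearMap.mul'_apply, h]
  simp only [endComul_apply, map_sum, LinearMap.sum_apply, endTensorAct_tmul,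
    TensorProduct.map_tmul, map_smul, traceComul_apply, Finset.smul_sum]
  refine Finset.sum_congr rfl fun k _ => Finset.sum_congr rfl fun i _ => ?_
  simp [Algebra.algebraMap_eq_smul_one, TensorProduct.smul_tmul', Algebra.traceForm_apply]

theorem endTensorAct_endComul_tmul (α : Module.End K E) (x y : E) :
    endTensorAct K E (endComul K E α) (x ⊗ₜ y) = traceComul K E (α (x * y)) := by
  simp [endTensorAct_endComul]

theorem endTensorAct₃_lTensor_endComul (t : Module.End K E ⊗[K] Module.End K E) :
    endTensorAct₃ K E ((endComul K E).lTensor _ t) =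
      (traceComul K E).lTensor E ∘ₗ endTensorAct K E t ∘ₗ (LinearMap.mul' K E).lTensor E := by
  induction t with
  | zero => simp
  | add t₁ t₂ h₁ h₂ => simp only [map_add, h₁, h₂, LinearMap.add_comp, LinearMap.comp_add]
  | tmul α β => ext x y z; simp [endTensorAct_endComul]

theorem endTensorAct₃_rTensor_endComul (t : Module.End K E ⊗[K] Module.End K E) :
    endTensorAct₃ K E (TensorProduct.assoc K _ _ _ ((endComul K E).rTensor _ t)) =
      TensorProduct.assoc K E E E ∘ₗ (traceComul K E).rTensor E ∘ₗ endTensorAct K E t ∘ₗ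
        (LinearMap.mul' K E).rTensor E ∘ₗ (TensorProduct.assoc K E E E).symm := by
  induction t with
  | zero => simp
  | add t₁ t₂ h₁ h₂ => simp only [map_add, h₁, h₂, LinearMap.add_comp, LinearMap.comp_add]
  | tmul α β => ext x y z; simp [endTensorAct₃_assoc_tmul, endTensorAct_endComul]

theorem endComul_coassoc : TensorProduct.assoc K (Module.End K E) (Module.End K E) (Module.End K E) ∘ₗ
    (endComul K E).rTensor (Module.End K E) ∘ₗ endComul K E =
      (endComul K E).lTensor (Module.End K E) ∘ₗ endComul K E := by
  ext1 α
  apply endTensorAct₃_injective K E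
  simp only [LinearMap.comp_apply, LinearEquiv.coe_coe]
  rw [endTensorAct₃_rTensor_endComul, endTensorAct₃_lTensor_endComul]
  ext x y z
  simp [endTensorAct_endComul_tmul, traceComul_coassoc, mul_assoc]

/-- Since `μ ∘ δ = id`, the inner factors of `δ α μ δ β μ` cancel. -/
theorem endComul_mul (α β : Module.End K E) :
    endComul K E (α * β) = endComul K E α * endComul K E β := by
  apply endTensorAct_injective K E
  rw [map_mul (endTensorAct K E)]
  ext x y
  have h (a : E) : LinearMap.mul' K E (traceComul K E a) = a := by
    rw [traceComul_apply, map_sum]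
    simp only [LinearMap.mul'_apply, ← mul_assoc, ← Finset.sum_mul,
      sum_endBasis_mul_endDualBasis, one_mul]
  simp [endTensorAct_endComul, h]

theorem endComul_one_left : (endComul K E).lTensor _ (endComul K E 1) =
    TensorProduct.assoc K _ _ _ (endComul K E 1 ⊗ₜ[K] (1 : Module.End K E)) *
      ((1 : Module.End K E) ⊗ₜ[K] endComul K E 1) := by
  apply endTensorAct₃_injective K E
  rw [map_mul, endTensorAct₃_lTensor_endComul, endTensorAct₃_assoc_tmul]
  ext x y z
  simp only [TensorProduct.AlgebraTensorModule.curry_apply, TensorProduct.curry_apply,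
    LinearMap.coe_restrictScalars, LinearMap.comp_apply, LinearMap.mul'_apply,
    LinearMap.lTensor_tmul, endTensorAct_endComul_tmul, Module.End.mul_apply, endTensorAct₃_tmul,
    TensorProduct.map_tmul, Module.End.one_apply, LinearEquiv.coe_coe]
  -- This is `(μ ⊗ 1)(1 ⊗ δ) = δ μ` followed by coassociativity; the opposite order of factors needs
  -- only the bimodule property.
  rw [← traceComul_coassoc, traceComul_mul K E x, traceComul_apply K E (y * z)]
  simp only [TensorProduct.tmul_sum, map_sum, TensorProduct.assoc_symm_tmul,
    TensorProduct.map_tmul, endTensorAct_endComul_tmul, LinearMap.rTensor_tmul,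
    Module.End.one_apply]

theorem endComul_one_right : (endComul K E).lTensor _ (endComul K E 1) =
    ((1 : Module.End K E) ⊗ₜ[K] endComul K E 1) *
      TensorProduct.assoc K _ _ _ (endComul K E 1 ⊗ₜ[K] (1 : Module.End K E)) := by
  apply endTensorAct₃_injective K E
  rw [map_mul, endTensorAct₃_lTensor_endComul, endTensorAct₃_assoc_tmul]
  ext x y z
  simp only [TensorProduct.AlgebraTensorModule.curry_apply, TensorProduct.curry_apply,
    LinearMap.coe_restrictScalars, LinearMap.comp_apply, LinearMap.mul'_apply,
    LinearMap.lTensor_tmul, endTensorAct_endComul_tmul, Module.End.mul_apply, endTensorAct₃_tmul,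
    TensorProduct.map_tmul, Module.End.one_apply, LinearEquiv.coe_coe,
    TensorProduct.assoc_symm_tmul]
  rw [traceComul_apply K E (x * y), traceComul_apply K E (x * (y * z))]
  simp only [TensorProduct.sum_tmul, map_sum, TensorProduct.assoc_tmul, LinearMap.lTensor_tmul,
    TensorProduct.map_tmul, endTensorAct_endComul_tmul, Module.End.one_apply, mul_assoc]

end Comul

/-! ### The antipode as trace adjoint, and the weak Hopf axioms. -/

section Weak

variable (K E : Type*) [Field K] [Field E] [Algebra K E]
variable [FiniteDimensional K E] [Algebra.IsSeparable K E]

/-- The antipode is the adjoint with respect to the trace form. -/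
theorem trace_endAntipode_mul (α : Module.End K E) (x y : E) :
    Algebra.trace K E (endAntipode K E α x * y) = Algebra.trace K E (x * α y) := by
  conv_rhs => rw [← sum_trace_endBasis_mul_smul K E y]
  simp only [endAntipode_apply, Finset.sum_mul, map_sum, Finset.mul_sum, map_smul, mul_smul_comm,
    smul_mul_assoc, smul_eq_mul]
  exact Finset.sum_congr rfl fun i _ => mul_comm _ _

theorem endAntipode_lmul_mul_mul_lmul (α : Module.End K E) (a c x : E) :
    endAntipode K E (Algebra.lmul K E a * α * Algebra.lmul K E c) x =
      c * endAntipode K E α (a * x) := by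
  refine eq_of_trace_mul_eq K fun w => ?_
  rw [trace_endAntipode_mul, mul_comm c, mul_assoc (endAntipode K E α _), trace_endAntipode_mul]
  simp only [Module.End.mul_apply, Algebra.coe_lmul_eq_mul, LinearMap.mul_apply']
  congr 1
  ring

/-- Taking the adjoint of the rank-one map `x ↦ Tr(c x) a` swaps `a` and `c`. -/
theorem endAntipode_lmul_mul_trace (a c x : E) :
    endAntipode K E (Algebra.lmul K E a * (Algebra.linearMap K E ∘ₗ Algebra.traceForm K E c)) x =
      Algebra.trace K E (a * x) • c := by
  refine eq_of_trace_mul_eq K fun w => ?_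
  rw [trace_endAntipode_mul]
  simp only [Module.End.mul_apply, Algebra.coe_lmul_eq_mul, LinearMap.mul_apply',
    LinearMap.comp_apply, Algebra.linearMap_apply, Algebra.traceForm_apply, smul_mul_assoc,
    map_smul, smul_eq_mul]
  rw [← mul_assoc, mul_comm (x * a), ← Algebra.smul_def, map_smul, smul_eq_mul, mul_comm x,
    mul_comm]

theorem endAntipode_one : endAntipode K E 1 = 1 := by
  ext x
  exact eq_of_trace_mul_eq K fun w => trace_endAntipode_mul K E 1 x w

/-- The sum over `k` collapses by `∑ bₖ dₖ = 1`; adjunction turns `Tr(S(α)(dᵢ v))` into `Tr(dᵢ v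
α(1))`, the coordinates of `v α(1)`. -/
theorem mul'_lTensor_endAntipode_endComul (α : Module.End K E) :
    LinearMap.mul' K _ ((endAntipode K E).lTensor _ (endComul K E α)) =
      Algebra.lmul K E (α 1) := by
  ext v
  simp only [endComul_apply, map_sum, LinearMap.lTensor_tmul, LinearMap.mul'_apply,
    LinearMap.sum_apply, Module.End.mul_apply, endAntipode_lmul_mul_mul_lmul]
  simp only [Algebra.coe_lmul_eq_mul, LinearMap.mul_apply', LinearMap.comp_apply,
    Algebra.linearMap_apply, Algebra.traceForm_apply]
  rw [Finset.sum_comm]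
  refine eq_of_trace_mul_eq K fun w => ?_
  simp only [← Finset.mul_sum, ← map_sum, ← mul_assoc, ← Finset.sum_mul]
  rw [Finset.sum_congr rfl fun i _ => mul_comm (endDualBasis K E i) (endBasis K E i),
    sum_endBasis_mul_endDualBasis]
  simp only [one_mul]
  congr 2
  rw [mul_comm (α 1), ← sum_trace_endDualBasis_mul_smul K E (v * α 1)]
  refine Finset.sum_congr rfl fun i _ => ?_
  rw [← mul_assoc, ← trace_endAntipode_mul, mul_one, mul_comm, Algebra.smul_def]

theorem mul'_rTensor_endAntipode_endComul (α : Module.End K E) :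
    LinearMap.mul' K _ ((endAntipode K E).rTensor _ (endComul K E α)) =
      Algebra.lmul K E (endAntipode K E α 1) := by
  ext v
  simp only [endComul_apply, map_sum, LinearMap.rTensor_tmul, LinearMap.mul'_apply,
    LinearMap.sum_apply, Module.End.mul_apply, endAntipode_lmul_mul_trace]
  simp only [Algebra.coe_lmul_eq_mul, LinearMap.mul_apply']
  conv_rhs => rw [mul_comm, ← sum_trace_endBasis_mul_smul K E (v * endAntipode K E α 1)]
  refine Finset.sum_congr rfl fun k _ => ?_
  rw [← Finset.sum_smul, ← map_sum, ← mul_assoc, mul_comm (endBasis K E k * v),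
    trace_endAntipode_mul, one_mul]
  simp only [← mul_assoc, ← Finset.sum_mul, sum_endBasis_mul_endDualBasis, one_mul]

theorem lid_rTensor_trace_traceComul (a : E) :
    TensorProduct.lid K E ((Algebra.trace K E).rTensor E (traceComul K E a)) = a := by
  simp only [traceComul_apply, map_sum, LinearMap.rTensor_tmul, TensorProduct.lid_tmul]
  conv_rhs => rw [← one_mul a, ← sum_trace_endBasis_mul_smul K E 1]
  simp only [mul_one, Finset.sum_mul, smul_mul_assoc]

theorem rid_lTensor_trace_traceComul (α : Module.End K E) (a : E) :
    TensorProduct.rid K E ((Algebra.trace K E ∘ₗ α).lTensor E (traceComul K E a)) =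
      endAntipode K E α 1 * a := by
  simp only [traceComul_apply, map_sum, LinearMap.lTensor_tmul, TensorProduct.rid_tmul,
    LinearMap.comp_apply]
  rw [← sum_trace_endDualBasis_mul_smul K E (endAntipode K E α 1 * a)]
  refine Finset.sum_congr rfl fun k _ => ?_
  rw [mul_left_comm, trace_endAntipode_mul, one_mul]

theorem isWeakHopfAlgebra_end :
    IsWeakHopfAlgebra (endComul K E) (endCounit K E) (endAntipode K E) where
  coassoc := endComul_coassoc K E
  counit_left α := by
    ext v
    have h := lid_rTensor_endCounit K E 1 (endComul K E α) v
    rw [LinearMap.mulRight_one, LinearMap.comp_id] at h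
    rw [h, endTensorAct_endComul_tmul, lid_rTensor_trace_traceComul, Module.End.one_apply, one_mul]
  counit_right α := by
    ext v
    have h := rid_lTensor_endCounit K E 1 (endComul K E α) v
    rw [LinearMap.mulLeft_one, LinearMap.comp_id] at h
    rw [h, endTensorAct_endComul_tmul, rid_lTensor_trace_traceComul, endAntipode_one,
      Module.End.one_apply, mul_one, one_mul]
  comul_mul := endComul_mul K E
  comul_one := endComul_one_left K E
  comul_one' := endComul_one_right K E
  counit_mul x y z := by
    have h := rid_lTensor_trace_traceComul K E 1 (y (z 1))
    rw [endAntipode_one, Module.End.one_apply, one_mul] at h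
    rw [mul'_map_endCounit, endTensorAct_endComul_tmul, one_mul]
    exact congrArg (fun a => Algebra.trace K E (x a)) h.symm
  counit_mul' x y z := by
    rw [mul'_map_endCounit', endTensorAct_endComul_tmul, mul_one, lid_rTensor_trace_traceComul]
    rfl
  mul_antipode x := by
    rw [mul'_lTensor_endAntipode_endComul]
    ext v
    rw [lid_rTensor_endCounit, endTensorAct_endComul_tmul, lid_rTensor_trace_traceComul]
    rfl
  antipode_mul x := by
    rw [mul'_rTensor_endAntipode_endComul]
    ext v
    rw [rid_lTensor_endCounit, endTensorAct_endComul_tmul, rid_lTensor_trace_traceComul, mul_one]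
    rfl
  antipode_mul_antipode x := by
    ext v
    simp only [endComul_apply K E x, map_sum, TensorProduct.map_tmul, LinearMap.comp_apply,
      mul'_rTensor_endAntipode_endComul, LinearMap.mul'_apply, LinearMap.sum_apply,
      Module.End.mul_apply, endAntipode_lmul_mul_mul_lmul, endAntipode_lmul_mul_trace]
    simp only [Algebra.coe_lmul_eq_mul, LinearMap.mul_apply']
    rw [Finset.sum_comm]
    -- The weights `Tr(bᵢ)` come from `S(x₁)(1)`, and `1 = ∑ Tr(bᵢ) dᵢ`.
    conv_rhs => rw [← one_mul v, ← sum_trace_endBasis_mul_smul K E 1, Finset.sum_mul, map_sum]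
    refine Finset.sum_congr rfl fun i _ => ?_
    simp only [smul_mul_assoc, ← Finset.smul_sum, map_smul, ← mul_assoc, ← Finset.sum_mul]
    rw [Finset.sum_congr rfl fun i _ => mul_comm (endDualBasis K E i) (endBasis K E i),
      sum_endBasis_mul_endDualBasis, one_mul]

end Weak

/-! ### The Galois correspondence. -/

section Galois

variable {K E : Type*} [Field K] [Field E] [Algebra K E]

/-- On `F`-linear endomorphisms, the coproduct can be computed with dual bases of `E` over `F` in
place of `K`. -/
theorem endComul_eq_sum_intermediateField [FiniteDimensional K E] [Algebra.IsSeparable K E]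
    (F : IntermediateField K E) (α : Module.End K E) (hα : α ∈ endGal F) :
    endComul K E α = ∑ k, ∑ i,
      (Algebra.lmul K E (endBasis K E i) * (Algebra.linearMap F E ∘ₗ
        Algebra.traceForm F E (endDualBasis F E k)).restrictScalars K) ⊗ₜ[K]
      (Algebra.lmul K E (endDualBasis K E i) * α * Algebra.lmul K E (endBasis F E k)) := by
  apply endTensorAct_injective K E
  ext x y
  -- Only the sum over `k` passes to `F`. The sum over `i` stays over `K`, as its factors are
  -- multiplications, already in `Gal(F)`.
  have h : α (x * y) = ∑ k, algebraMap F E (Algebra.trace F E (endDualBasis F E k * x)) *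
      α (endBasis F E k * y) := by
    conv_lhs => rw [← sum_trace_endDualBasis_mul_smul F E x, Finset.sum_mul, map_sum]
    refine Finset.sum_congr rfl fun k _ => ?_
    rw [smul_mul_assoc, Algebra.smul_def, mul_comm,
      hα _ (algebraMap F E _) (Subtype.prop _), mul_comm]
  simp only [TensorProduct.AlgebraTensorModule.curry_apply, TensorProduct.curry_apply,
    LinearMap.coe_restrictScalars, endTensorAct_endComul_tmul, h, map_sum, traceComul_mul,
    LinearMap.sum_apply, endTensorAct_tmul, TensorProduct.map_tmul]
  refine Finset.sum_congr rfl fun k _ => Finset.sum_congr rfl fun i _ => ?_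
  simp [Algebra.traceForm_apply, mul_comm]

theorem isWeakHopfSubalgebra_endGal [FiniteDimensional K E] [Algebra.IsSeparable K E]
    (F : IntermediateField K E) :
    IsWeakHopfSubalgebra (endComul K E) (endAntipode K E) (endGal F) where
  comul_mem α hα := by
    rw [endComul_eq_sum_intermediateField F α hα]
    refine Submodule.sum_mem _ fun k _ => Submodule.sum_mem _ fun i _ => ?_
    have h1 : Algebra.lmul K E (endBasis K E i) * (Algebra.linearMap F E ∘ₗ
        Algebra.traceForm F E (endDualBasis F E k)).restrictScalars K ∈ endGal F :=
      mul_mem (lmul_range_le_endGal F ⟨_, rfl⟩) ((mem_endGal_iff F _).2 ⟨_, rfl⟩)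
    have h2 : Algebra.lmul K E (endDualBasis K E i) * α * Algebra.lmul K E (endBasis F E k) ∈
        endGal F :=
      mul_mem (mul_mem (lmul_range_le_endGal F ⟨_, rfl⟩) hα) (lmul_range_le_endGal F ⟨_, rfl⟩)
    exact ⟨⟨_, h1⟩ ⊗ₜ ⟨_, h2⟩, rfl⟩
  antipode_mem α hα x y hy := by
    refine eq_of_trace_mul_eq K fun w => ?_
    rw [trace_endAntipode_mul, mul_assoc, mul_assoc, trace_endAntipode_mul, mul_comm y w,
      hα w y hy, mul_comm y]

theorem endFix_endGal (F : IntermediateField K E) :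
    endFix (endGal F) (lmul_range_le_endGal F) = F := by
  apply le_antisymm
  · intro x hx
    -- The retraction, viewed in `End E_K`, lies in `Gal(F)` and sends `1` to `1`, so it maps each
    -- fixed `x` to itself, placing `x` in `F`.
    obtain ⟨f, hf⟩ := (Algebra.linearMap F E).exists_leftInverse_of_injective
      (LinearMap.ker_eq_bot.2 (algebraMap F E).injective)
    have h := hx (((Algebra.linearMap F E) ∘ₗ f).restrictScalars K)
      ((mem_endGal_iff F _).2 ⟨_, rfl⟩)
    have h1 : f 1 = 1 := by simpa using LinearMap.congr_fun hf 1
    simp only [LinearMap.restrictScalars_apply, LinearMap.comp_apply, h1] at h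
    simp only [Algebra.linearMap_apply, map_one, one_mul] at h
    rw [← h]
    exact (f x).2
  · intro x hx α hα
    simpa using hα 1 x hx

theorem endGal_endFix [FiniteDimensional K E] (W : Subalgebra K (Module.End K E))
    (hW : (Algebra.lmul K E).range ≤ W) : endGal (endFix W hW) = W := by
  apply le_antisymm
  · intro α hα
    have hsimple : IsSimpleModule W E := by
      rw [isSimpleModule_iff_toSpanSingleton_surjective]
      refine ⟨inferInstance, fun x hx y => ⟨⟨Algebra.lmul K E (y * x⁻¹), hW ⟨_, rfl⟩⟩, ?_⟩⟩
      simp [Subalgebra.smul_def, hx]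
    have hend (g : Module.End W E) (x : E) : g x = x * g 1 := by
      have := g.map_smul ⟨Algebra.lmul K E x, hW ⟨_, rfl⟩⟩ 1
      simpa [Subalgebra.smul_def] using this
    -- `W`-linearity gives `β(g(1)) = g(β(1)) = β(1) g(1)`.
    have hfix (g : Module.End W E) : g 1 ∈ endFix W hW := fun β hβ => by
      have := g.map_smul ⟨β, hβ⟩ 1
      simp only [Subalgebra.smul_def, Module.End.smul_def] at this
      rw [← this, hend]
    let f : Module.End (Module.End W E) E :=
      { toFun := α
        map_add' := α.map_add
        map_smul' := fun g x => by
          simp only [Module.End.smul_def, RingHom.id_apply]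
          rw [hend g x, hα x _ (hfix g), hend g (α x)] }
    classical
    -- Agreement with some `r ∈ W` on a finite `K`-basis already forces `α = r`.
    obtain ⟨r, hr⟩ := jacobson_density (R := W) (M := E) f (Finset.univ.image (Module.finBasis K E))
    have : α = r := (Module.finBasis K E).ext fun i => hr _ (by simp)
    rw [this]
    exact r.2
  · intro α hα x y hy
    have := hy (α * Algebra.lmul K E x) (W.mul_mem hα (hW ⟨x, rfl⟩))
    simpa using this

end Galois

theorem corollary7p2 (K E : Type*) [Field K] [Field E] [Algebra K E]
    [FiniteDimensional K E] [Algebra.IsSeparable K E] :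
    IsWeakHopfAlgebra (endComul K E) (endCounit K E) (endAntipode K E) ∧
    (∀ F : IntermediateField K E,
      IsWeakHopfSubalgebra (endComul K E) (endAntipode K E) (endGal F) ∧
      (Algebra.lmul K E).range ≤ endGal F) ∧
    (∀ F : IntermediateField K E, endFix (endGal F) (lmul_range_le_endGal F) = F) ∧
    (∀ (W : Subalgebra K (Module.End K E)) (hW : (Algebra.lmul K E).range ≤ W),
      IsWeakHopfSubalgebra (endComul K E) (endAntipode K E) W → endGal (endFix W hW) = W) :=
  ⟨isWeakHopfAlgebra_end K E,
    fun F => ⟨isWeakHopfSubalgebra_endGal F, lmul_range_le_endGal F⟩,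
    endFix_endGal, fun W hW _ => endGal_endFix W hW⟩
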